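/- Let $(X_n)_{n\ge1}$ and $(Y_n)_{n\ge1}$ be a hidden Markov model with state space $\mathbb R$ and real observations: $X_1$ has density $\mu$; $X$ is a Markov chain with transition density $q$, i.e. $\mathbb P(X_{n+1}\in A\mid X_1,\dots,X_n)=\int_A q(X_n,v)\,dv$ a.s. for Borel $A$ and $n\ge1$; and, given the whole sequence $(X_n)_{n\ge1}$, the variables $Y_1,Y_2,\dots$ are independent and $Y_n$ has density $p(X_n,\cdot)$. Put $$L_n(x_{1:n};y_{1:n})=\mu(x_1)p(x_1,y_1)\prod_{m=2}^n q(x_{m-1},x_m)p(x_m,y_m),\qquad x_{1:n},y_{1:n}\in\mathbb R^n .$$ Assume the following. 1. $\mu$ is a $C^2$ log-concave function on $\mathbb R$ and $-\log\mu\ge 0$ (with $-\log 0=+\infty$). 2. $q(u,v)=c_q e^{-\alpha(u,v)}$ with a constant $c_q>0$ and a nonnegative convex function $\alpha\in C^2(\mathbb R^2)$. 3. $p(x,y)=c_p e^{-\gamma(x,y)}$ with a constant $c_p>0$ and a function $\gamma\ge0$ such that, for every $y$, the function $x\mapsto\gamma(x,y)$ is $C^2$, and $\frac{\partial^2}{\partial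 x^2}\gamma(x,y)\ge\kappa$ for all $x,y\in\mathbb R$, with a constant $\kappa>0$. 4. There is a constant $C$ such that $\limsup_{n\to\infty}\bigl(-\frac1n\log L_n(X_{1:n};Y_{1:n})\bigr)\le C$ almost surely. 5. There is a non-decreasing function $g:\mathbb R_+\to\mathbb R_+$ that tends to $+\infty$ at infinity, and does so at most polynomially, such that for all $M>0$ and all $x,y\in\mathbb R$, $\alpha(x,y)\le M$ implies $\bigl|\frac{\partial^2}{\partial x\,\partial y}\alpha(x,y)\bigr|\le g(M)$. For $n\ge1$ let $\hat X^n_{1:n}=\operatorname{argmax}_{x_{1:n}\in\mathbb R^n}L_n(x_{1:n};Y_{1:n})$ be the MAP (Viterbi) path; in case of ambiguity the lexicographically first maximizer is taken. Then: (a) for every $n$ and every $y_{1:n}\in\mathbb R^n$ the function $L_n(\cdot\,;y_{1:n})$ has exactly one maximizer, so that $\hat X^n_{1:n}$ is well defined; (b) for every fixed $m\ge1$ the limit $\lim_{n\to\infty}\hat X^n_{1:m}$ exists in $\mathbb R^m$ almost surely; (c) almost surely, $\lim_{n\to\infty}n^r\,\bigl|\hat X^{n+1}_1-\hat X^n_1\bigr|=0$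 for every $r\in\mathbb N$. -/

import Mathlib

open MeasureTheory ProbabilityTheory Filter Topology Asymptotics
open scoped NNReal

/-- A nonnegative function `f` on the real line is log-concave if
`f (a x + b y) ≥ f x ^ a * f y ^ b` whenever `a, b > 0` and `a + b = 1`. It may vanish
(then `- log f = +∞`). -/
def LogConcave (f : ℝ → ℝ) : Prop :=
  (∀ x, 0 ≤ f x) ∧
    ∀ x y a b : ℝ, 0 < a → 0 < b → a + b = 1 → f x ^ a * f y ^ b ≤ f (a * x + b * y)

/-- `(X, Y)` is a hidden Markov model on `(Ω, P)` with state space `ℝ`, initial density `μ`,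
transition density `q u v` (of the next state `v` given the present state `u`) and observation
density `p x y` (of the observation `y` given the state `x`). The random variables
`X 0, X 1, …` and `Y 0, Y 1, …` are `X_1, X_2, …` and `Y_1, Y_2, …`. -/
structure IsHiddenMarkovModel {Ω : Type*} [MeasurableSpace Ω] (P : Measure Ω)
    (X Y : ℕ → Ω → ℝ) (μ : ℝ → ℝ) (q p : ℝ → ℝ → ℝ) : Prop where
  measurable_state : ∀ n, Measurable (X n)
  measurable_obs : ∀ n, Measurable (Y n)
  measurable_init_density : Measurable μ
  init_density_nonneg : ∀ u, 0 ≤ μ u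
  measurable_trans_density : Measurable (Function.uncurry q)
  trans_density_nonneg : ∀ u v, 0 ≤ q u v
  trans_density_mass : ∀ u, ∫⁻ v, ENNReal.ofReal (q u v) = 1
  measurable_obs_density : Measurable (Function.uncurry p)
  obs_density_nonneg : ∀ x y, 0 ≤ p x y
  obs_density_mass : ∀ x, ∫⁻ y, ENNReal.ofReal (p x y) = 1
  /-- The first state has density `μ`. -/
  init : P.map (X 0) = volume.withDensity (fun u => ENNReal.ofReal (μ u))
  /-- Markov property: `P(X_{n+1} ∈ A | X_1, …, X_n) = ∫_A q(X_n, v) dv` almost surely. -/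
  markov : ∀ (n : ℕ) (A : Set ℝ), MeasurableSet A →
    P⟦X (n + 1) ⁻¹' A | ⨆ i ≤ n, MeasurableSpace.comap (X i) inferInstance⟧
      =ᵐ[P] fun ω => ∫ v in A, q (X n ω) v
  /-- Given the whole state sequence, the observations are independent, and the `i`-th one has
  density `p (X_i, ·)`. -/
  obs : ∀ (n : ℕ) (B : Fin n → Set ℝ), (∀ i, MeasurableSet (B i)) →
    P⟦{ω | ∀ i, Y i ω ∈ B i} | ⨆ i, MeasurableSpace.comap (X i) inferInstance⟧
      =ᵐ[P] fun ω => ∏ i, ∫ y in B i, p (X i ω) y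

/-- The posterior likelihood
`L_n(x_{1:n}; y_{1:n}) = μ(x_1) p(x_1,y_1) ∏_{m=2}^n q(x_{m-1},x_m) p(x_m,y_m)`. -/
noncomputable def likelihood (μ : ℝ → ℝ) (q p : ℝ → ℝ → ℝ) :
    (n : ℕ) → (Fin n → ℝ) → (Fin n → ℝ) → ℝ
  | 0, _, _ => 1
  | n + 1, x, y => μ (x 0) * p (x 0) (y 0) *
      ∏ i : Fin n, q (x i.castSucc) (x i.succ) * p (x i.succ) (y i.succ)

/-- `x` maximizes `L_n(·; y)` over `ℝⁿ`. -/
def IsLikelihoodMaximizer (μ : ℝ → ℝ) (q p : ℝ → ℝ → ℝ) (n : ℕ) (y x : Fin n → ℝ) : Prop :=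
  ∀ z : Fin n → ℝ, likelihood μ q p n z y ≤ likelihood μ q p n x y

/-- `x` is the MAP path for the observations `y`: the lexicographically first maximizer of
`L_n(·; y)` over `ℝⁿ`. -/
def IsMAPPath (μ : ℝ → ℝ) (q p : ℝ → ℝ → ℝ) (n : ℕ) (y x : Fin n → ℝ) : Prop :=
  IsLikelihoodMaximizer μ q p n y x ∧
    ∀ z, IsLikelihoodMaximizer μ q p n y z → toLex x ≤ toLex z

open Classical in
/-- The MAP (Viterbi) path for the observations `y` (zero if there is none). -/
noncomputable def mapPath (μ : ℝ → ℝ) (q p : ℝ → ℝ → ℝ) (n : ℕ) (y : Fin n → ℝ) : Fin n → ℝ :=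
  if h : ∃ x, IsMAPPath μ q p n y x then h.choose else 0

/-- The mixed derivative `∂²α/∂x∂y` at `(x, y)`. -/
noncomputable def mixedDeriv (α : ℝ → ℝ → ℝ) (x y : ℝ) : ℝ :=
  deriv (fun s => deriv (fun t => α s t) y) x

/-! Up to normalizing constants, the negative log-likelihood is an energy to which the observation
terms give convexity of modulus `κ`, uniformly in the length. This yields a unique maximizer and
`quadratic_growth` around it.

Let `x`, `z` be the MAP paths for two consecutive lengths, `d = z - x`, and let `T m` be the sum of
`d i ^ 2` over `i ≤ m`. Both paths are stationary. Testing stationarity with `d` cut off after index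
`m` and subtracting leaves a single coupling to the later entries, so `κ * T m` is at most a
difference of first partial derivatives of `α` (`curvature_mul_sum_sq_le`). If `α ≤ M` at both
transitions, convexity disposes of the pure second derivative and the bound `G` on the mixed one
gives `κ * T m ≤ G * |d m| * |d (m + 1)|`. Hence `T (m + 1) ≥ (1 + (κ / G) ^ 2) * T m`
(`one_add_mul_sum_sq_le`): an early disagreement is amplified along the path.

The hidden path is a competitor, so almost surely the energies of the MAP paths grow at most
linearly. By Markov's inequality, for `M` large, roughly half of the indices amplify. Since `T n`
itself is at most linear in `n`, each fixed `T m` must decay geometrically in `n`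
(`exists_geometric_bound`). This gives convergence of every entry and the decay rate. -/

/-! ### Tangent inequalities and second derivatives of convex functions -/

/-- A convex function lies above its tangent along a segment. -/
theorem ConvexOn.add_le_of_hasDerivAt_segment {E : Type*} [AddCommGroup E] [Module ℝ E]
    {s : Set E} {f : E → ℝ} (hf : ConvexOn ℝ s f) {x y : E} (hx : x ∈ s) (hy : y ∈ s) {c : ℝ}
    (h : HasDerivAt (fun t : ℝ => f (x + t • (y - x))) c 0) : f x + c ≤ f y := by
  have h1 := (hasDerivWithinAt_iff_tendsto_slope' (s := Set.Ioi (0 : ℝ)) (by simp)).1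
    h.hasDerivWithinAt
  suffices c ≤ f y - f x by linarith
  refine le_of_tendsto h1 ?_
  have h2 : Set.Ioc (0 : ℝ) 1 ∈ 𝓝[>] (0 : ℝ) := Ioc_mem_nhdsGT one_pos
  filter_upwards [h2] with t ht
  have h3 := hf.2 hx hy (sub_nonneg.2 ht.2) ht.1.le (by ring)
  have h4 : (1 - t) • x + t • y = x + t • (y - x) := by module
  rw [h4] at h3
  simp only [smul_eq_mul] at h3
  rw [slope_def_field, sub_zero, div_le_iff₀ ht.1]
  simp only [zero_smul, add_zero]
  linarith

theorem hasDerivAt_comp_segment {E : Type*} [NormedAddCommGroup E] [NormedSpace ℝ E]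
    {G : Type*} [NormedAddCommGroup G] [NormedSpace ℝ G]
    {f : E → G} {x v : E} {t : ℝ} (hf : DifferentiableAt ℝ f (x + t • v)) :
    HasDerivAt (fun s : ℝ => f (x + s • v)) (fderiv ℝ f (x + t • v) v) t := by
  have h1 : HasDerivAt (fun s : ℝ => x + s • v) v t := by
    simpa using ((hasDerivAt_id t).smul_const v).const_add x
  exact hf.hasFDerivAt.comp_hasDerivAt t h1

theorem ConvexOn.add_fderiv_le {E : Type*} [NormedAddCommGroup E] [NormedSpace ℝ E]
    {f : E → ℝ} (hf : ConvexOn ℝ Set.univ f) (hd : Differentiable ℝ f) (x y : E) :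
    f x + fderiv ℝ f x (y - x) ≤ f y := by
  refine hf.add_le_of_hasDerivAt_segment (Set.mem_univ x) (Set.mem_univ y) ?_
  simpa using hasDerivAt_comp_segment (x := x) (v := y - x) (t := 0) (hd _)

/-- The second derivative of a convex function is positive semidefinite. -/
theorem ConvexOn.fderiv_fderiv_nonneg {E : Type*} [NormedAddCommGroup E] [NormedSpace ℝ E]
    {f : E → ℝ} (hf : ConvexOn ℝ Set.univ f) (hs : ContDiff ℝ 2 f) (x w : E) :
    0 ≤ fderiv ℝ (fderiv ℝ f) x w w := by
  have hd : Differentiable ℝ f := hs.differentiable (by norm_num)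
  have hd' : Differentiable ℝ (fderiv ℝ f) :=
    (hs.fderiv_right (m := 1) (by norm_num)).differentiable (by norm_num)
  -- Adding the tangent inequalities at two points of a line shows that the directional derivative
  -- increases along it; its derivative is the quadratic form.
  have hmono : Monotone fun t : ℝ => fderiv ℝ f (x + t • w) w := by
    refine monotone_iff_forall_lt.2 fun a b hab => ?_
    have h1 := hf.add_fderiv_le hd (x + a • w) (x + b • w)
    have h2 := hf.add_fderiv_le hd (x + b • w) (x + a • w)
    have e1 : x + b • w - (x + a • w) = (b - a) • w := by module
    have e2 : x + a • w - (x + b • w) = -((b - a) • w) := by module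
    rw [e1, map_smul, smul_eq_mul] at h1
    rw [e2, map_neg, map_smul, smul_eq_mul] at h2
    have h3 : 0 < b - a := sub_pos.2 hab
    exact le_of_mul_le_mul_left (by linarith) h3
  have h := (hasDerivAt_comp_segment (x := x) (v := w) (t := 0) (hd' _)).clm_apply
    (hasDerivAt_const (0 : ℝ) w)
  simp only [zero_smul, add_zero, map_zero] at h
  rw [← h.deriv]
  exact hmono.deriv_nonneg

theorem mixedDeriv_eq_fderiv_fderiv {α : ℝ → ℝ → ℝ} (hs : ContDiff ℝ 2 (Function.uncurry α))
    (x y : ℝ) :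
    mixedDeriv α x y = fderiv ℝ (fderiv ℝ (Function.uncurry α)) (x, y) (1, 0) (0, 1) := by
  have hd : Differentiable ℝ (Function.uncurry α) := hs.differentiable (by norm_num)
  have hd' : Differentiable ℝ (fderiv ℝ (Function.uncurry α)) :=
    (hs.fderiv_right (m := 1) (by norm_num)).differentiable (by norm_num)
  have h1 : ∀ s, deriv (fun t => α s t) y = fderiv ℝ (Function.uncurry α) (s, y) (0, 1) := by
    intro s
    have h := hasDerivAt_comp_segment (x := (s, (0 : ℝ))) (v := ((0 : ℝ), (1 : ℝ))) (t := y)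
      (hd _)
    simp only [Prod.smul_mk, Prod.mk_add_mk, smul_eq_mul, mul_zero, mul_one, add_zero,
      zero_add] at h
    exact h.deriv
  unfold mixedDeriv
  simp only [h1]
  have h := (hasDerivAt_comp_segment (x := ((0 : ℝ), y)) (v := ((1 : ℝ), (0 : ℝ))) (t := x)
      (hd' _)).clm_apply (hasDerivAt_const x ((0 : ℝ), (1 : ℝ)))
  simp only [Prod.smul_mk, Prod.mk_add_mk, smul_eq_mul, mul_zero, mul_one, add_zero,
      zero_add, map_zero] at h
  exact h.deriv

/-- On a sublevel set, a bound on the mixed derivative bounds the loss of monotonicity of the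
first partial derivative of a convex function. -/
theorem neg_mul_le_fderiv_sub_fderiv {α : ℝ → ℝ → ℝ} (hs : ContDiff ℝ 2 (Function.uncurry α))
    (hc : ConvexOn ℝ Set.univ (Function.uncurry α)) {M G : ℝ}
    (hG : ∀ u v, α u v ≤ M → |mixedDeriv α u v| ≤ G) {u v u' v' : ℝ}
    (h : α u v ≤ M) (h' : α u' v' ≤ M) :
    -(G * |u' - u| * |v' - v|) ≤ fderiv ℝ (Function.uncurry α) (u', v') (u' - u, 0) -
      fderiv ℝ (Function.uncurry α) (u, v) (u' - u, 0) := by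
  set a := u' - u
  set b := v' - v
  have hd' : Differentiable ℝ (fderiv ℝ (Function.uncurry α)) :=
    (hs.fderiv_right (m := 1) (by norm_num)).differentiable (by norm_num)
  have hder : ∀ t : ℝ, HasDerivAt
      (fun t : ℝ => fderiv ℝ (Function.uncurry α) ((u, v) + t • (a, b)) (a, 0))
      (fderiv ℝ (fderiv ℝ (Function.uncurry α)) ((u, v) + t • (a, b)) (a, b) (a, 0)) t := by
    intro t
    have := (hasDerivAt_comp_segment (x := (u, v)) (v := (a, b)) (t := t) (hd' _)).clm_apply
      (hasDerivAt_const t (a, (0 : ℝ)))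
    simpa using this
  obtain ⟨t, ht, hte⟩ := exists_hasDerivAt_eq_slope _ _ (zero_lt_one (α := ℝ))
    (fun t _ => (hder t).continuousAt.continuousWithinAt) (fun t _ => hder t)
  have e1 : (u, v) + (1 : ℝ) • (a, b) = (u', v') := by simp [a, b]
  rw [e1, zero_smul, add_zero, sub_zero, div_one] at hte
  rw [← hte]
  set z : ℝ × ℝ := (u, v) + t • (a, b) with hz
  -- Sublevel sets of a convex function are convex, so the mean value point still obeys the bound
  -- `G`.
  have hle : α z.1 z.2 ≤ M := by
    have h1 := hc.2 (Set.mem_univ (u, v)) (Set.mem_univ (u', v')) (sub_nonneg.2 ht.2.le) ht.1.le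
      (by ring)
    have h2 : (1 - t) • (u, v) + t • (u', v') = z := by
      ext <;> simp [hz, a, b] <;> ring
    rw [h2] at h1
    simp only [smul_eq_mul, Function.uncurry] at h1
    nlinarith [ht.1, ht.2]
  have hmix := hG _ _ hle
  rw [mixedDeriv_eq_fderiv_fderiv hs] at hmix
  have hsymm : IsSymmSndFDerivAt ℝ (Function.uncurry α) z :=
    hs.contDiffAt.isSymmSndFDerivAt (by simp)
  set D := fderiv ℝ (fderiv ℝ (Function.uncurry α)) z
  -- The pure second derivative is nonnegative by convexity, so only the mixed term can cause a
  -- loss.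
  have hdec : D (a, b) (a, 0) = D (a, 0) (a, 0) + a * b * D (1, 0) (0, 1) := by
    have e2 : (a, b) = (a, 0) + b • ((0 : ℝ), (1 : ℝ)) := by ext <;> simp
    have e3 : (a, (0 : ℝ)) = a • ((1 : ℝ), (0 : ℝ)) := by ext <;> simp
    have e4 : D (b • ((0 : ℝ), (1 : ℝ))) (a, 0) = a * b * D (1, 0) (0, 1) := by
      rw [e3, map_smul, map_smul, smul_apply, hsymm.eq]
      simp only [smul_eq_mul]
      ring
    rw [e2, map_add, add_apply, e4]
  have hnn : 0 ≤ D (a, 0) (a, 0) := hc.fderiv_fderiv_nonneg hs z (a, 0)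
  have habs : |a * b * D (1, 0) (0, 1)| ≤ G * |a| * |b| := by
    rw [abs_mul, abs_mul]
    nlinarith [mul_nonneg (abs_nonneg a) (abs_nonneg b)]
  rw [hdec]
  linarith [(abs_le.1 habs).1]

/-- If `f'' ≥ κ`, then `f` lies above its tangent parabolas of curvature `κ`. -/
theorem add_deriv_mul_add_sq_le {f : ℝ → ℝ} (hf : ContDiff ℝ 2 f) {κ : ℝ}
    (h : ∀ x, κ ≤ iteratedDeriv 2 f x) (x z : ℝ) :
    f x + deriv f x * (z - x) + κ / 2 * (z - x) ^ 2 ≤ f z := by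
  have hd : Differentiable ℝ f := hf.differentiable (by norm_num)
  have hd' : Differentiable ℝ (deriv f) := by
    have : ContDiff ℝ 1 (deriv f) := by
      have := (contDiff_succ_iff_deriv (n := 1) (f := f)).1 (by norm_num; exact hf)
      exact this.2.2
    exact this.differentiable (by norm_num)
  have hψ : ∀ x, HasDerivAt (fun x => f x - κ / 2 * x ^ 2) (deriv f x - κ * x) x := by
    intro x
    have h1 : HasDerivAt (fun x : ℝ => κ / 2 * x ^ 2) (κ * x) x := by
      refine ((hasDerivAt_pow 2 x).const_mul (κ / 2)).congr_deriv ?_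
      push_cast
      ring
    exact (hd x).hasDerivAt.fun_sub h1
  have hψd : deriv (fun x => f x - κ / 2 * x ^ 2) = fun x => deriv f x - κ * x :=
    funext fun x => (hψ x).deriv
  have hψ2 : ∀ x, HasDerivAt (fun x => deriv f x - κ * x) (deriv (deriv f) x - κ) x := by
    intro x
    have h1 : HasDerivAt (fun x : ℝ => κ * x) κ x := by
      simpa using (hasDerivAt_id x).const_mul κ
    exact (hd' x).hasDerivAt.fun_sub h1
  have hconv : ConvexOn ℝ Set.univ (fun x => f x - κ / 2 * x ^ 2) := by
    refine convexOn_univ_of_deriv2_nonneg (fun x => (hψ x).differentiableAt) ?_ ?_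
    · rw [hψd]
      exact fun x => (hψ2 x).differentiableAt
    · intro x
      simp only [Function.iterate_succ, Function.iterate_zero, Function.comp_apply, id]
      rw [hψd, (hψ2 x).deriv]
      have := h x
      simp only [iteratedDeriv_succ, iteratedDeriv_zero] at this
      linarith
  have := hconv.add_fderiv_le (fun x => (hψ x).differentiableAt) x z
  rw [fderiv_eq_smul_deriv, (hψ x).deriv, smul_eq_mul] at this
  nlinarith

/-- The tangent inequality for the logarithm of a log-concave function. -/
theorem LogConcave.log_le {μ : ℝ → ℝ} (hμ : LogConcave μ) (hd : Differentiable ℝ μ) {x z : ℝ}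
    (hx : 0 < μ x) (hz : 0 < μ z) :
    Real.log (μ z) ≤ Real.log (μ x) + deriv μ x / μ x * (z - x) := by
  have hseg : ∀ x z a b : ℝ, 0 < μ x → 0 < μ z → 0 < a → 0 < b → a + b = 1 →
      0 < μ (a * x + b * z) := fun x z a b hx hz ha hb hab =>
    (by positivity : 0 < μ x ^ a * μ z ^ b).trans_le (hμ.2 x z a b ha hb hab)
  -- Restricting to `{μ > 0}`, convex by log-concavity, avoids the default value `Real.log 0 = 0`.
  have hconv : ConvexOn ℝ {x | 0 < μ x} (fun x => -Real.log (μ x)) := by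
    refine convexOn_iff_forall_pos.2 ⟨convex_iff_forall_pos.2 ?_, ?_⟩
    · intro x hx z hz a b ha hb hab
      exact hseg x z a b hx hz ha hb hab
    · intro x hx z hz a b ha hb hab
      have hx' : 0 < μ x := hx
      have hz' : 0 < μ z := hz
      have h1 := Real.log_le_log (by positivity) (hμ.2 x z a b ha hb hab)
      rw [Real.log_mul (by positivity) (by positivity), Real.log_rpow hx', Real.log_rpow hz'] at h1
      simp only [smul_eq_mul]
      linarith
  have hder : HasDerivAt (fun t : ℝ => -Real.log (μ (x + t • (z - x))))
      (-(deriv μ x / μ x * (z - x))) 0 := by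
    have h1 : HasDerivAt (fun t : ℝ => x + t • (z - x)) (z - x) 0 := by
      simpa using ((hasDerivAt_id (0 : ℝ)).smul_const (z - x)).const_add x
    have h2 : HasDerivAt (fun t : ℝ => μ (x + t • (z - x))) (deriv μ x * (z - x)) 0 := by
      have : HasDerivAt μ (deriv μ x) (x + (0 : ℝ) • (z - x)) := by
        simpa using (hd x).hasDerivAt
      exact this.comp (0 : ℝ) h1
    have h3 := (h2.log (by simpa using hx.ne')).neg
    simp only [zero_smul, add_zero] at h3
    exact h3.congr_deriv (by rw [mul_div_right_comm])
  have := hconv.add_le_of_hasDerivAt_segment hx hz hder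
  linarith

/-! ### Path energy and its first variation -/

/-- The analytic assumptions on the initial density `μ`, the transition potential `α` and the
observation potential `γ`. -/
structure IsStronglyLogConcaveModel (μ : ℝ → ℝ) (α γ : ℝ → ℝ → ℝ) (κ : ℝ) : Prop where
  init_smooth : ContDiff ℝ 2 μ
  init_conc : LogConcave μ
  init_log_nonpos : ∀ u, 0 ≤ -Real.log (μ u)
  init_pos : ∃ u, 0 < μ u
  trans_nonneg : ∀ u v, 0 ≤ α u v
  trans_smooth : ContDiff ℝ 2 (Function.uncurry α)
  trans_conv : ConvexOn ℝ Set.univ (Function.uncurry α)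
  obs_nonneg : ∀ x y, 0 ≤ γ x y
  obs_smooth : ∀ y, ContDiff ℝ 2 (fun x => γ x y)
  curvature_pos : 0 < κ
  obs_conv : ∀ x y, κ ≤ iteratedDeriv 2 (fun x' => γ x' y) x

/-- The energy of the first `n + 1` entries of the path `x`, given the observations `y`, without
the contribution of the initial density. -/
noncomputable def pathEnergy (α γ : ℝ → ℝ → ℝ) (y : ℕ → ℝ) (n : ℕ) (x : ℕ → ℝ) : ℝ :=
  γ (x 0) (y 0) +
    ∑ i ∈ Finset.range n, (α (x i) (x (i + 1)) + γ (x (i + 1)) (y (i + 1)))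

/-- The derivative of `pathEnergy` at `x` in the direction `v`. -/
noncomputable def pathEnergyDeriv (α γ : ℝ → ℝ → ℝ) (y : ℕ → ℝ) (n : ℕ) (x v : ℕ → ℝ) : ℝ :=
  deriv (fun s => γ s (y 0)) (x 0) * v 0 +
    ∑ i ∈ Finset.range n,
      (fderiv ℝ (Function.uncurry α) (x i, x (i + 1)) (v i, v (i + 1)) +
        deriv (fun s => γ s (y (i + 1))) (x (i + 1)) * v (i + 1))

/-- The path `x` maximizes `μ (x 0) * exp (-pathEnergy)` among all paths. -/
def IsPathMaximizer (μ : ℝ → ℝ) (α γ : ℝ → ℝ → ℝ) (y : ℕ → ℝ) (n : ℕ) (x : ℕ → ℝ) : Prop :=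
  ∀ z : ℕ → ℝ, μ (z 0) * Real.exp (-pathEnergy α γ y n z) ≤
    μ (x 0) * Real.exp (-pathEnergy α γ y n x)

theorem pathEnergyDeriv_neg (α γ : ℝ → ℝ → ℝ) (y : ℕ → ℝ) (n : ℕ) (x v : ℕ → ℝ) :
    pathEnergyDeriv α γ y n x (fun i => -v i) = -pathEnergyDeriv α γ y n x v := by
  unfold pathEnergyDeriv
  rw [neg_add, ← Finset.sum_neg_distrib, mul_neg]
  congr 1
  refine Finset.sum_congr rfl fun i _ => ?_
  rw [← Prod.neg_mk, map_neg]
  ring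

/-- Truncating the direction after index `m` leaves the derivative of the energy of the first
`m + 1` entries and one boundary term. -/
theorem pathEnergyDeriv_truncate (α γ : ℝ → ℝ → ℝ) (y : ℕ → ℝ) {m n : ℕ} (hmn : m < n)
    (x v : ℕ → ℝ) :
    pathEnergyDeriv α γ y n x (fun i => if i ≤ m then v i else 0) =
      pathEnergyDeriv α γ y m x v +
        fderiv ℝ (Function.uncurry α) (x m, x (m + 1)) (v m, 0) := by
  obtain ⟨k, rfl⟩ : ∃ k, n = m + 1 + k := ⟨n - (m + 1), by omega⟩
  unfold pathEnergyDeriv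
  rw [Finset.sum_range_add, Finset.sum_range_succ, add_assoc (deriv _ _ * v 0)]
  simp only [Nat.zero_le, if_true, le_refl]
  congr 1
  rw [Finset.sum_eq_zero (s := Finset.range k), add_zero]
  · congr 1
    · refine Finset.sum_congr rfl fun i hi => ?_
      have := Finset.mem_range.1 hi
      rw [if_pos (by omega), if_pos (by omega)]
    · rw [if_neg (by omega)]
      simp
  · intro i _
    rw [if_neg (by omega), if_neg (by omega), Prod.mk_zero_zero, map_zero, mul_zero, add_zero]

/-! ### Strong convexity and uniqueness of maximizers -/

namespace IsStronglyLogConcaveModel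

variable {μ : ℝ → ℝ} {α γ : ℝ → ℝ → ℝ} {κ : ℝ}

theorem pathEnergy_nonneg (h : IsStronglyLogConcaveModel μ α γ κ) (y : ℕ → ℝ) (n : ℕ)
    (x : ℕ → ℝ) : 0 ≤ pathEnergy α γ y n x :=
  add_nonneg (h.obs_nonneg _ _) (Finset.sum_nonneg fun _ _ =>
    add_nonneg (h.trans_nonneg _ _) (h.obs_nonneg _ _))

theorem pathEnergy_le_succ (h : IsStronglyLogConcaveModel μ α γ κ) (y : ℕ → ℝ) (n : ℕ)
    (x : ℕ → ℝ) : pathEnergy α γ y n x ≤ pathEnergy α γ y (n + 1) x := by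
  unfold pathEnergy
  rw [Finset.sum_range_succ]
  linarith [h.trans_nonneg (x n) (x (n + 1)), h.obs_nonneg (x (n + 1)) (y (n + 1))]

theorem sum_trans_le_pathEnergy (h : IsStronglyLogConcaveModel μ α γ κ) (y : ℕ → ℝ) (n : ℕ)
    (x : ℕ → ℝ) : ∑ i ∈ Finset.range n, α (x i) (x (i + 1)) ≤ pathEnergy α γ y n x := by
  unfold pathEnergy
  rw [Finset.sum_add_distrib]
  have := Finset.sum_nonneg fun i (_ : i ∈ Finset.range n) =>
    h.obs_nonneg (x (i + 1)) (y (i + 1))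
  linarith [h.obs_nonneg (x 0) (y 0)]

theorem obs_le_pathEnergy (h : IsStronglyLogConcaveModel μ α γ κ) (y : ℕ → ℝ) (n : ℕ)
    (x : ℕ → ℝ) {i : ℕ} (hi : i ≤ n) : γ (x i) (y i) ≤ pathEnergy α γ y n x := by
  unfold pathEnergy
  have hnn : ∀ j ∈ Finset.range n, 0 ≤ α (x j) (x (j + 1)) + γ (x (j + 1)) (y (j + 1)) :=
    fun _ _ => add_nonneg (h.trans_nonneg _ _) (h.obs_nonneg _ _)
  rcases i with _ | j
  · linarith [Finset.sum_nonneg hnn]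
  · have := Finset.single_le_sum hnn (Finset.mem_range.2 hi)
    linarith [h.obs_nonneg (x 0) (y 0), h.trans_nonneg (x j) (x (j + 1))]

theorem hasDerivAt_pathEnergy (h : IsStronglyLogConcaveModel μ α γ κ) (y : ℕ → ℝ) (n : ℕ)
    (x v : ℕ → ℝ) :
    HasDerivAt (fun t : ℝ => pathEnergy α γ y n (fun i => x i + t * v i))
      (pathEnergyDeriv α γ y n x v) 0 := by
  have hobs : ∀ i, HasDerivAt (fun t : ℝ => γ (x i + t * v i) (y i))
      (deriv (fun s => γ s (y i)) (x i) * v i) 0 := by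
    intro i
    have h1 := hasDerivAt_comp_segment (f := fun s => γ s (y i)) (x := x i) (v := v i) (t := 0)
      ((h.obs_smooth (y i)).differentiable (by norm_num) _)
    simpa [fderiv_eq_smul_deriv, mul_comm] using h1
  have htrans : ∀ i, HasDerivAt
      (fun t : ℝ => α (x i + t * v i) (x (i + 1) + t * v (i + 1)))
      (fderiv ℝ (Function.uncurry α) (x i, x (i + 1)) (v i, v (i + 1))) 0 := by
    intro i
    have h1 := hasDerivAt_comp_segment (f := Function.uncurry α) (x := (x i, x (i + 1)))
      (v := (v i, v (i + 1))) (t := 0) (h.trans_smooth.differentiable (by norm_num) _)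
    simpa only [zero_smul, add_zero, Prod.smul_mk, Prod.mk_add_mk, smul_eq_mul,
      Function.uncurry_apply_pair] using h1
  exact (hobs 0).fun_add (HasDerivAt.fun_sum fun i _ => (htrans i).fun_add (hobs (i + 1)))

/-- The tangent inequality for the energy, with the quadratic gain from the observations. -/
theorem pathEnergy_add_le (h : IsStronglyLogConcaveModel μ α γ κ) (y : ℕ → ℝ) (n : ℕ)
    (x z : ℕ → ℝ) :
    pathEnergy α γ y n x + pathEnergyDeriv α γ y n x (fun i => z i - x i) +
      κ / 2 * ∑ i ∈ Finset.range (n + 1), (z i - x i) ^ 2 ≤ pathEnergy α γ y n z := by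
  have hobs := fun i => add_deriv_mul_add_sq_le (h.obs_smooth (y i))
    (fun s => h.obs_conv s (y i)) (x i) (z i)
  have htrans := fun i => h.trans_conv.add_fderiv_le
    (h.trans_smooth.differentiable (by norm_num)) (x i, x (i + 1)) (z i, z (i + 1))
  simp only [Function.uncurry_apply_pair, Prod.mk_sub_mk] at htrans
  have hsum := Finset.sum_le_sum fun i (_ : i ∈ Finset.range n) =>
    add_le_add (htrans i) (hobs (i + 1))
  unfold pathEnergy pathEnergyDeriv
  rw [Finset.sum_range_succ']
  simp only [Finset.sum_add_distrib, ← Finset.mul_sum] at hsum ⊢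
  linarith [hobs 0]

theorem pos_of_isPathMaximizer (h : IsStronglyLogConcaveModel μ α γ κ) {y : ℕ → ℝ} {n : ℕ}
    {x : ℕ → ℝ} (hx : IsPathMaximizer μ α γ y n x) : 0 < μ (x 0) := by
  obtain ⟨u, hu⟩ := h.init_pos
  have := (mul_pos hu (Real.exp_pos _)).trans_le (hx fun _ => u)
  exact pos_of_mul_pos_left this (Real.exp_pos _).le

/-- A maximizer is stationary in every direction. -/
theorem pathEnergyDeriv_eq (h : IsStronglyLogConcaveModel μ α γ κ) {y : ℕ → ℝ} {n : ℕ}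
    {x : ℕ → ℝ} (hx : IsPathMaximizer μ α γ y n x) (v : ℕ → ℝ) :
    pathEnergyDeriv α γ y n x v = deriv μ (x 0) / μ (x 0) * v 0 := by
  have hpos := h.pos_of_isPathMaximizer hx
  have h1 := hasDerivAt_comp_segment (f := μ) (x := x 0) (v := v 0) (t := 0)
    (h.init_smooth.differentiable (by norm_num) _)
  -- Differentiating the product instead of its logarithm needs no positivity of `μ` away from `x
  -- 0`.
  have h2 := h1.mul (h.hasDerivAt_pathEnergy y n x v).fun_neg.exp
  have hmax : IsLocalMax ((fun t : ℝ => μ (x 0 + t • v 0)) *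
      fun t => Real.exp (-pathEnergy α γ y n fun i => x i + t * v i)) 0 := by
    refine Eventually.of_forall fun t => ?_
    simpa using hx fun i => x i + t * v i
  have h3 := hmax.hasDerivAt_eq_zero h2
  simp only [add_zero, zero_mul, fderiv_eq_smul_deriv, smul_eq_mul] at h3
  have h4 : Real.exp (-pathEnergy α γ y n x) *
      (v 0 * deriv μ (x 0) - μ (x 0) * pathEnergyDeriv α γ y n x v) = 0 := by
    linear_combination h3
  rcases mul_eq_zero.1 h4 with h5 | h5
  · exact absurd h5 (Real.exp_pos _).ne'
  · field_simp
    linarith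

/-- Quadratic growth of the negative log-likelihood away from a maximizer. -/
theorem quadratic_growth (h : IsStronglyLogConcaveModel μ α γ κ) {y : ℕ → ℝ} {n : ℕ}
    {x z : ℕ → ℝ} (hx : IsPathMaximizer μ α γ y n x) (hz : 0 < μ (z 0)) :
    -Real.log (μ (x 0)) + pathEnergy α γ y n x +
      κ / 2 * ∑ i ∈ Finset.range (n + 1), (z i - x i) ^ 2 ≤
        -Real.log (μ (z 0)) + pathEnergy α γ y n z := by
  have h1 := h.pathEnergy_add_le y n x z
  have h2 := h.init_conc.log_le (h.init_smooth.differentiable (by norm_num))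
    (h.pos_of_isPathMaximizer hx) hz
  rw [h.pathEnergyDeriv_eq hx] at h1
  linarith

theorem energy_le_of_isPathMaximizer (h : IsStronglyLogConcaveModel μ α γ κ) {y : ℕ → ℝ} {n : ℕ}
    {x z : ℕ → ℝ} (hx : IsPathMaximizer μ α γ y n x) (hz : 0 < μ (z 0)) :
    -Real.log (μ (x 0)) + pathEnergy α γ y n x ≤
        -Real.log (μ (z 0)) + pathEnergy α γ y n z := by
  have h1 := h.quadratic_growth hx hz
  have h2 : 0 ≤ κ / 2 * ∑ i ∈ Finset.range (n + 1), (z i - x i) ^ 2 :=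
    mul_nonneg (half_pos h.curvature_pos).le (Finset.sum_nonneg fun _ _ => sq_nonneg _)
  linarith

/-- Quadratic growth around `x`, combined with minimality of `z`, forces the sum of squares to
vanish. -/
theorem eq_of_isPathMaximizer (h : IsStronglyLogConcaveModel μ α γ κ) {y : ℕ → ℝ} {n : ℕ}
    {x z : ℕ → ℝ} (hx : IsPathMaximizer μ α γ y n x) (hz : IsPathMaximizer μ α γ y n z) {i : ℕ}
    (hi : i ≤ n) : x i = z i := by
  have h1 := h.quadratic_growth hx (h.pos_of_isPathMaximizer hz)
  have h2 := h.energy_le_of_isPathMaximizer hz (h.pos_of_isPathMaximizer hx)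
  have h3 := Finset.single_le_sum (f := fun i => (z i - x i) ^ 2) (fun _ _ => sq_nonneg _)
    (Finset.mem_range.2 (Nat.lt_succ_of_le hi))
  have h4 : κ / 2 * (z i - x i) ^ 2 ≤ 0 :=
    (mul_le_mul_of_nonneg_left h3 (half_pos h.curvature_pos).le).trans (by linarith)
  have h5 : (z i - x i) ^ 2 ≤ 0 := nonpos_of_mul_nonpos_right h4 (half_pos h.curvature_pos)
  have h6 : z i - x i = 0 := pow_eq_zero_iff (two_ne_zero) |>.1 (le_antisymm h5 (sq_nonneg _))
  linarith

/-! ### Comparison of maximizers of different lengths -/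

/-- The distance between two maximizers for different lengths is controlled by a boundary
term. -/
theorem curvature_mul_sum_sq_le (h : IsStronglyLogConcaveModel μ α γ κ) {y : ℕ → ℝ} {m n n' : ℕ}
    {x z : ℕ → ℝ} (hx : IsPathMaximizer μ α γ y n x) (hz : IsPathMaximizer μ α γ y n' z)
    (hm : m < n) (hm' : m < n') :
    κ * ∑ i ∈ Finset.range (m + 1), (z i - x i) ^ 2 ≤
      -(fderiv ℝ (Function.uncurry α) (z m, z (m + 1)) (z m - x m, 0) -
        fderiv ℝ (Function.uncurry α) (x m, x (m + 1)) (z m - x m, 0)) := by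
  have h1 := h.pathEnergy_add_le y m x z
  have h2 := h.pathEnergy_add_le y m z x
  have e2 : (fun i => x i - z i) = fun i => -(z i - x i) := by ext; ring
  have e3 : ∑ i ∈ Finset.range (m + 1), (x i - z i) ^ 2 =
      ∑ i ∈ Finset.range (m + 1), (z i - x i) ^ 2 :=
    Finset.sum_congr rfl fun i _ => by ring
  rw [e2, pathEnergyDeriv_neg, e3] at h2
  -- The truncated direction is admissible in the stationarity condition of each path, whatever its
  -- length.
  have h3 := pathEnergyDeriv_truncate α γ y hm x (fun i => z i - x i)
  have h4 := pathEnergyDeriv_truncate α γ y hm' z (fun i => z i - x i)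
  rw [h.pathEnergyDeriv_eq hx] at h3
  rw [h.pathEnergyDeriv_eq hz] at h4
  simp only [Nat.zero_le, if_true] at h3 h4
  have hd := h.init_smooth.differentiable (by norm_num)
  -- Together these say that the logarithmic derivative of `μ` is nonincreasing, so the initial
  -- terms have the favourable sign.
  have h5 := h.init_conc.log_le hd (h.pos_of_isPathMaximizer hx) (h.pos_of_isPathMaximizer hz)
  have h6 := h.init_conc.log_le hd (h.pos_of_isPathMaximizer hz) (h.pos_of_isPathMaximizer hx)
  linarith

/-- At an index where both transitions have bounded potential, the partial sums of the squared
distances grow by a fixed factor. -/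
theorem one_add_mul_sum_sq_le (h : IsStronglyLogConcaveModel μ α γ κ) {M G : ℝ} (hG0 : 0 < G)
    (hG : ∀ u v, α u v ≤ M → |mixedDeriv α u v| ≤ G) {y : ℕ → ℝ} {m n n' : ℕ}
    {x z : ℕ → ℝ} (hx : IsPathMaximizer μ α γ y n x) (hz : IsPathMaximizer μ α γ y n' z)
    (hm : m < n) (hm' : m < n') (hxM : α (x m) (x (m + 1)) ≤ M)
    (hzM : α (z m) (z (m + 1)) ≤ M) :
    (1 + (κ / G) ^ 2) * ∑ i ∈ Finset.range (m + 1), (z i - x i) ^ 2 ≤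
      ∑ i ∈ Finset.range (m + 2), (z i - x i) ^ 2 := by
  have h1 := h.curvature_mul_sum_sq_le hx hz hm hm'
  have h2 := neg_mul_le_fderiv_sub_fderiv h.trans_smooth h.trans_conv hG hxM hzM
  rw [Finset.sum_range_succ _ (m + 1)]
  set T := ∑ i ∈ Finset.range (m + 1), (z i - x i) ^ 2 with hT
  have hT0 : 0 ≤ T := Finset.sum_nonneg fun _ _ => sq_nonneg _
  have h3 : κ * T ≤ G * (|z m - x m| * |z (m + 1) - x (m + 1)|) := by linarith
  have h4 : (z m - x m) ^ 2 ≤ T := Finset.single_le_sum (f := fun i => (z i - x i) ^ 2)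
    (fun _ _ => sq_nonneg _) (Finset.self_mem_range_succ m)
  have h5 : κ / G * T ≤ |z m - x m| * |z (m + 1) - x (m + 1)| := by
    rw [div_mul_eq_mul_div, div_le_iff₀ hG0]
    linarith
  -- After squaring, `(z m - x m) ^ 2 ≤ T` leaves one factor `T` on the right, which is then
  -- cancelled unless `T = 0`.
  have h6 : (κ / G * T) ^ 2 ≤ T * (z (m + 1) - x (m + 1)) ^ 2 := by
    have h7 : 0 ≤ κ / G * T := mul_nonneg (div_pos h.curvature_pos hG0).le hT0
    refine (pow_le_pow_left₀ h7 h5 2).trans ?_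
    rw [mul_pow, sq_abs, sq_abs]
    exact mul_le_mul_of_nonneg_right h4 (sq_nonneg _)
  suffices (κ / G) ^ 2 * T ≤ (z (m + 1) - x (m + 1)) ^ 2 by linarith
  rcases hT0.eq_or_lt with h0 | h0
  · rw [← h0, mul_zero]
    positivity
  · refine le_of_mul_le_mul_left ?_ h0
    linarith [h6, (by ring : (κ / G * T) ^ 2 = T * ((κ / G) ^ 2 * T))]

end IsStronglyLogConcaveModel

/-! ### Amplification against linear energy: geometric decay -/

/-- A nondecreasing sequence that gains a factor `exp l` at every index `i` with `A i ≤ M` grows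
exponentially if the `A i` are small on average. -/
theorem mul_exp_le_of_growth_of_le {T A : ℕ → ℝ} {l M : ℝ} (hl : 0 ≤ l) (hM : 0 < M)
    (hT : ∀ i, 0 ≤ T i) (hmono : ∀ i, T i ≤ T (i + 1)) (hA : ∀ i, 0 ≤ A i) {m n : ℕ}
    (hgrow : ∀ i < n, A i ≤ M → Real.exp l * T i ≤ T (i + 1)) (hmn : m ≤ n) :
    T m * Real.exp (l * ((n - m : ℝ) - (∑ i ∈ Finset.range n, A i) / M)) ≤ T n := by
  induction n, hmn using Nat.le_induction with
  | base =>
    refine mul_le_of_le_one_right (hT m) (Real.exp_le_one_iff.2 ?_)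
    have h1 : 0 ≤ (∑ i ∈ Finset.range m, A i) / M :=
      div_nonneg (Finset.sum_nonneg fun i _ => hA i) hM.le
    exact mul_nonpos_of_nonneg_of_nonpos hl (by linarith)
  | succ n hmn ih =>
    have ih' := ih fun i hi => hgrow i (by omega)
    -- This factor serves both cases: it is at most `exp l` if `A n ≤ M` and below `1` otherwise (if
    -- `l > 0`), so Markov's inequality is built into the induction.
    have h1 : Real.exp (l * (1 - A n / M)) * T n ≤ T (n + 1) := by
      by_cases hle : A n ≤ M
      · refine le_trans ?_ (hgrow n (Nat.lt_succ_self n) hle)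
        refine mul_le_mul_of_nonneg_right (Real.exp_le_exp.2 ?_) (hT n)
        exact mul_le_of_le_one_right hl (by linarith [div_nonneg (hA n) hM.le])
      · refine le_trans (mul_le_of_le_one_left (hT n) (Real.exp_le_one_iff.2 ?_)) (hmono n)
        have : 1 < A n / M := (one_lt_div hM).2 (not_le.1 hle)
        exact mul_nonpos_of_nonneg_of_nonpos hl (by linarith)
    refine le_trans (le_of_eq ?_) ((mul_le_mul_of_nonneg_left ih' (Real.exp_pos _).le).trans h1)
    rw [mul_left_comm, ← Real.exp_add, Finset.sum_range_succ]
    congr 2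
    push_cast
    ring

/-- If the energies of the maximizers grow at most linearly in the length, then the increments of
each entry decay geometrically. -/
theorem IsStronglyLogConcaveModel.exists_geometric_bound {μ : ℝ → ℝ} {α γ : ℝ → ℝ → ℝ} {κ : ℝ}
    (h : IsStronglyLogConcaveModel μ α γ κ)
    (hmixed : ∀ M : ℝ, 0 < M → ∃ G : ℝ, ∀ u v, α u v ≤ M → |mixedDeriv α u v| ≤ G)
    {y : ℕ → ℝ} {x : ℕ → ℕ → ℝ} (hx : ∀ n, IsPathMaximizer μ α γ y n (x n)) {K : ℝ} {N : ℕ}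
    (hK : ∀ n ≥ N, -Real.log (μ (x n 0)) + pathEnergy α γ y n (x n) ≤ K * (n + 1)) :
    ∃ r : ℝ, 0 < r ∧ r < 1 ∧ ∀ m, ∃ D : ℝ, ∀ n ≥ N, m ≤ n →
      |x (n + 1) m - x n m| ≤ D * r ^ n := by
  wlog hKpos : 0 < K generalizing K
  · refine this (K := 1) (fun n hn => (hK n hn).trans ?_) one_pos
    have : (0 : ℝ) < n + 1 := by positivity
    exact mul_le_mul_of_nonneg_right (by linarith) this.le
  -- The two paths have total transition potential at most `3 * K * (n + 1)`; the level `6 * K` is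
  -- twice the resulting average, so about half of the indices stay below it.
  obtain ⟨G₀, hG₀⟩ := hmixed (6 * K) (by positivity)
  set G := max G₀ 1
  have hGpos : 0 < G := lt_max_of_lt_right one_pos
  have hG : ∀ u v, α u v ≤ 6 * K → |mixedDeriv α u v| ≤ G := fun u v huv =>
    (hG₀ u v huv).trans (le_max_left _ _)
  have hκ := h.curvature_pos
  have hρ : 0 < (κ / G) ^ 2 := by positivity
  set l := Real.log (1 + (κ / G) ^ 2)
  have hl : 0 < l := Real.log_pos (by linarith)
  have hexpl : Real.exp l = 1 + (κ / G) ^ 2 := Real.exp_log (by linarith)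
  -- The amplification exponent is about `l * n / 2`. Absorbing the linear bound on `T n` costs `l *
  -- n / 4`, and the square root halves the remaining `l * n / 4`.
  refine ⟨Real.exp (-(l / 8)), Real.exp_pos _, Real.exp_lt_one_iff.2 (by linarith), fun m => ?_⟩
  set B := 2 / κ * K * (4 / l + 2)
  have hB : 0 < B := by positivity
  refine ⟨√(B * Real.exp (l * (m + 1 / 2))), fun n hn hmn => ?_⟩
  set T : ℕ → ℝ := fun k => ∑ i ∈ Finset.range (k + 1), (x (n + 1) i - x n i) ^ 2
  set A : ℕ → ℝ := fun i => α (x n i) (x n (i + 1)) + α (x (n + 1) i) (x (n + 1) (i + 1))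
  have hE := hK n hn
  have hE' := hK (n + 1) (by omega)
  push_cast at hE'
  have hA : ∑ i ∈ Finset.range n, A i ≤ 3 * K * (n + 1) := by
    rw [Finset.sum_add_distrib]
    have h1 := h.sum_trans_le_pathEnergy y n (x n)
    have h2 := h.sum_trans_le_pathEnergy y n (x (n + 1))
    have h3 := h.pathEnergy_le_succ y n (x (n + 1))
    have h4 := h.init_log_nonpos (x n 0)
    have h5 := h.init_log_nonpos (x (n + 1) 0)
    nlinarith [(Nat.cast_nonneg n : (0 : ℝ) ≤ n)]
  -- The longer MAP path, cut to the shorter length, is the competitor in the quadratic growth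
  -- estimate.
  have hTn : T n ≤ 2 / κ * K * (n + 2) := by
    have h1 := h.quadratic_growth (hx n) (h.pos_of_isPathMaximizer (hx (n + 1)))
    have h2 := h.pathEnergy_le_succ y n (x (n + 1))
    have h3 := h.pathEnergy_nonneg y n (x n)
    have h4 := h.init_log_nonpos (x n 0)
    have h5 : κ / 2 * T n ≤ K * (n + 2) := by linarith
    calc T n = 2 / κ * (κ / 2 * T n) := by field_simp
      _ ≤ 2 / κ * (K * (n + 2)) := mul_le_mul_of_nonneg_left h5 (by positivity)
      _ = _ := by ring
  have hgrowth := mul_exp_le_of_growth_of_le (T := T) (A := A) (l := l) (M := 6 * K) (m := m)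
    (n := n) hl.le (by positivity) (fun k => Finset.sum_nonneg fun _ _ => sq_nonneg _)
    (fun k => by
      simp only [T]
      rw [Finset.sum_range_succ _ (k + 1)]
      linarith [sq_nonneg (x (n + 1) (k + 1) - x n (k + 1))])
    (fun i => add_nonneg (h.trans_nonneg _ _) (h.trans_nonneg _ _))
    (fun i hi hAi => by
      rw [hexpl]
      exact h.one_add_mul_sum_sq_le hGpos hG (hx n) (hx (n + 1)) hi (by omega)
        (by linarith [h.trans_nonneg (x (n + 1) i) (x (n + 1) (i + 1))])
        (by linarith [h.trans_nonneg (x n i) (x n (i + 1))])) hmn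
  have hrate : l * ((n - 1 : ℝ) / 2 - m) ≤
      l * ((n - m : ℝ) - (∑ i ∈ Finset.range n, A i) / (6 * K)) := by
    refine mul_le_mul_of_nonneg_left ?_ hl.le
    have : (∑ i ∈ Finset.range n, A i) / (6 * K) ≤ (n + 1) / 2 := by
      rw [div_le_iff₀ (by positivity)]
      linarith
    linarith
  have hlin : (n + 2 : ℝ) ≤ (4 / l + 2) * Real.exp (l * n / 4) := by
    have h1 := Real.add_one_le_exp (l * n / 4)
    have h2 : 1 ≤ Real.exp (l * n / 4) := Real.one_le_exp (by positivity)
    have h3 : (n : ℝ) = 4 / l * (l * n / 4) := by field_simp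
    have h4 : 4 / l * (l * n / 4) ≤ 4 / l * Real.exp (l * n / 4) :=
      mul_le_mul_of_nonneg_left (by linarith) (by positivity)
    linarith
  have hTm : T m ≤ B * Real.exp (l * (m + 1 / 2)) * Real.exp (-(l / 8)) ^ (2 * n) := by
    have h1 : T m * Real.exp (l * ((n - 1 : ℝ) / 2 - m)) ≤ B * Real.exp (l * n / 4) :=
      calc T m * Real.exp (l * ((n - 1 : ℝ) / 2 - m)) ≤ T n :=
            (mul_le_mul_of_nonneg_left (Real.exp_le_exp.2 hrate)
              (Finset.sum_nonneg fun _ _ => sq_nonneg _)).trans hgrowth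
        _ ≤ 2 / κ * K * (n + 2) := hTn
        _ ≤ 2 / κ * K * ((4 / l + 2) * Real.exp (l * n / 4)) :=
            mul_le_mul_of_nonneg_left hlin (by positivity)
        _ = _ := by ring
    rw [← le_div_iff₀ (Real.exp_pos _), mul_div_assoc, ← Real.exp_sub] at h1
    refine h1.trans (le_of_eq ?_)
    rw [← Real.exp_nat_mul, mul_assoc B, ← Real.exp_add]
    congr 2
    push_cast
    ring
  have hsq : (x (n + 1) m - x n m) ^ 2 ≤ T m :=
    Finset.single_le_sum (f := fun i => (x (n + 1) i - x n i) ^ 2)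
      (fun _ _ => sq_nonneg _) (Finset.self_mem_range_succ m)
  refine abs_le_of_sq_le_sq (hsq.trans (hTm.trans (le_of_eq ?_))) (by positivity)
  rw [mul_pow, Real.sq_sqrt (by positivity), ← pow_mul, mul_comm 2 n]

/-! ### Coercivity and existence of maximizers -/

theorem pathEnergy_congr {α γ : ℝ → ℝ → ℝ} {y y' x z : ℕ → ℝ} {n : ℕ}
    (hxz : ∀ i ≤ n, x i = z i) (hy : ∀ i ≤ n, y i = y' i) :
    pathEnergy α γ y n x = pathEnergy α γ y' n z := by
  unfold pathEnergy
  rw [hxz 0 (Nat.zero_le n), hy 0 (Nat.zero_le n)]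
  congr 1
  refine Finset.sum_congr rfl fun i hi => ?_
  have := Finset.mem_range.1 hi
  rw [hxz i (by omega), hxz (i + 1) (by omega), hy (i + 1) (by omega)]

/-- A function with `f'' ≥ κ > 0` is coercive. -/
theorem exists_abs_le_of_le {f : ℝ → ℝ} (hf : ContDiff ℝ 2 f) {κ : ℝ} (hκ : 0 < κ)
    (h : ∀ x, κ ≤ iteratedDeriv 2 f x) (K : ℝ) : ∃ R : ℝ, 0 ≤ R ∧ ∀ x, f x ≤ K → |x| ≤ R := by
  -- Beyond this radius the quadratic term of the tangent parabola at `0` beats the linear and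
  -- constant terms; the summand `1` gives `|x| ≥ 1`.
  refine ⟨2 / κ * (|deriv f 0| + |K - f 0|) + 1, by positivity, fun x hx => ?_⟩
  have h1 := add_deriv_mul_add_sq_le hf h 0 x
  simp only [sub_zero] at h1
  by_contra! hlt
  have h2 : |deriv f 0| + |K - f 0| < κ / 2 * |x| :=
    calc |deriv f 0| + |K - f 0| = κ / 2 * (2 / κ * (|deriv f 0| + |K - f 0|)) := by field_simp
      _ < κ / 2 * |x| := mul_lt_mul_of_pos_left (by linarith) (half_pos hκ)
  have h3 : 1 ≤ |x| := le_trans (le_add_of_nonneg_left (by positivity)) hlt.le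
  have h4 : -(|deriv f 0| * |x|) ≤ deriv f 0 * x := by
    rw [← abs_mul]
    exact neg_abs_le _
  have h5 : K - f 0 ≤ |K - f 0| := le_abs_self _
  have h6 : |x| ^ 2 = x ^ 2 := sq_abs x
  nlinarith [mul_lt_mul_of_pos_right h2 (by linarith : 0 < |x|),
    mul_le_mul_of_nonneg_left h3 (abs_nonneg (K - f 0))]

/-- Coercivity of the observation terms confines every path at least as likely as a constant one to
a box, which is compact by Tychonoff's theorem. -/
theorem IsStronglyLogConcaveModel.exists_isPathMaximizer {μ : ℝ → ℝ} {α γ : ℝ → ℝ → ℝ} {κ : ℝ}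
    (h : IsStronglyLogConcaveModel μ α γ κ) (y : ℕ → ℝ) (n : ℕ) :
    ∃ x, IsPathMaximizer μ α γ y n x := by
  obtain ⟨u, hu⟩ := h.init_pos
  set J : (ℕ → ℝ) → ℝ := fun z => μ (z 0) * Real.exp (-pathEnergy α γ y n z) with hJdef
  have hJu : 0 < J fun _ => u := mul_pos hu (Real.exp_pos _)
  choose R hR0 hR using fun i => exists_abs_le_of_le (h.obs_smooth (y i)) h.curvature_pos
    (fun s => h.obs_conv s (y i)) (-Real.log (J fun _ => u))
  have hcompact : IsCompact (Set.univ.pi fun i => Set.Icc (-R i) (R i)) :=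
    isCompact_univ_pi fun i => isCompact_Icc
  have hcont : Continuous J := by
    have hα := h.trans_smooth.continuous
    refine (h.init_smooth.continuous.comp (continuous_apply 0)).mul
      (Real.continuous_exp.comp (Continuous.neg ?_))
    have hγ : ∀ i, Continuous fun z : ℕ → ℝ => γ (z i) (y i) := fun i =>
      (h.obs_smooth (y i)).continuous.comp (continuous_apply i)
    refine (hγ 0).add (continuous_finsetSum _ fun i _ => Continuous.add ?_ (hγ (i + 1)))
    exact hα.comp (f := fun z : ℕ → ℝ => (z i, z (i + 1)))
      ((continuous_apply i).prodMk (continuous_apply (i + 1)))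
  obtain ⟨x, -, hx⟩ := hcompact.exists_isMaxOn
    ⟨0, fun i _ => ⟨neg_nonpos.2 (hR0 i), hR0 i⟩⟩ hcont.continuousOn
  have hlarge : ∀ z, (J fun _ => u) ≤ J z → J z ≤ J x := by
    intro z hz
    have hμ0 := h.init_conc.1 (z 0)
    have hμ1 : μ (z 0) ≤ 1 := (Real.log_nonpos_iff hμ0).1 (neg_nonneg.1 (h.init_log_nonpos _))
    have h1 : (J fun _ => u) ≤ Real.exp (-pathEnergy α γ y n z) :=
      hz.trans (mul_le_of_le_one_left (Real.exp_pos _).le hμ1)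
    have h2 := (Real.log_le_log hJu h1).trans_eq (Real.log_exp _)
    -- Entries after index `n` do not affect `J`; setting them to zero puts the path in the box.
    have h3 : J z = J fun i => if i ≤ n then z i else 0 := by
      simp only [hJdef, Nat.zero_le, if_true]
      congr 3
      exact pathEnergy_congr (fun i hi => (if_pos hi).symm) fun _ _ => rfl
    rw [h3]
    refine isMaxOn_iff.1 hx (fun i => if i ≤ n then z i else 0) fun i _ => ?_
    beta_reduce
    split_ifs with hi
    · exact abs_le.1 (hR i _ (by linarith [h.obs_le_pathEnergy y n z hi]))
    · exact ⟨neg_nonpos.2 (hR0 i), hR0 i⟩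
  refine ⟨x, fun z => ?_⟩
  rcases le_total (J fun _ => u) (J z) with hz | hz
  · exact hlarge z hz
  · exact hz.trans (hlarge (fun _ => u) le_rfl)

/-! ### From path energies to the likelihood and the MAP path -/

/-- Extension of a finite path by zero. -/
noncomputable def extendPath {n : ℕ} (x : Fin n → ℝ) (j : ℕ) : ℝ :=
  if h : j < n then x ⟨j, h⟩ else 0

@[simp]
theorem extendPath_val {n : ℕ} (x : Fin n → ℝ) (i : Fin n) : extendPath x i = x i := by
  simp [extendPath]

theorem likelihood_eq_exp_pathEnergy {μ : ℝ → ℝ} {q p α γ : ℝ → ℝ → ℝ} {cq cp : ℝ}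
    (hq : ∀ u v, q u v = cq * Real.exp (-α u v)) (hp : ∀ x y, p x y = cp * Real.exp (-γ x y))
    (n : ℕ) (x y : ℕ → ℝ) :
    likelihood μ q p (n + 1) (fun i => x i) (fun i => y i) =
      cp ^ (n + 1) * cq ^ n * (μ (x 0) * Real.exp (-pathEnergy α γ y n x)) := by
  have hterm : ∀ i : ℕ, q (x i) (x (i + 1)) * p (x (i + 1)) (y (i + 1)) =
      cq * cp * Real.exp (-(α (x i) (x (i + 1)) + γ (x (i + 1)) (y (i + 1)))) := by
    intro i
    rw [hq, hp, neg_add, Real.exp_add]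
    ring
  simp only [likelihood, Fin.val_zero, Fin.val_castSucc, Fin.val_succ]
  rw [Fin.prod_univ_eq_prod_range
    (fun i => q (x i) (x (i + 1)) * p (x (i + 1)) (y (i + 1))) n]
  simp only [hterm]
  rw [Finset.prod_mul_distrib, Finset.prod_const, Finset.card_range, ← Real.exp_sum, hp,
    Finset.sum_neg_distrib, pathEnergy, neg_add, Real.exp_add]
  ring

section MAPPath

variable {μ : ℝ → ℝ} {q p α γ : ℝ → ℝ → ℝ} {κ cq cp : ℝ}

theorem isLikelihoodMaximizer_iff_isPathMaximizer (hcq : 0 < cq) (hcp : 0 < cp)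
    (hq : ∀ u v, q u v = cq * Real.exp (-α u v)) (hp : ∀ x y, p x y = cp * Real.exp (-γ x y))
    (n : ℕ) (x : Fin (n + 1) → ℝ) (y : ℕ → ℝ) :
    IsLikelihoodMaximizer μ q p (n + 1) (fun i => y i) x ↔
      IsPathMaximizer μ α γ y n (extendPath x) := by
  have hc : 0 < cp ^ (n + 1) * cq ^ n := by positivity
  have hx := likelihood_eq_exp_pathEnergy (μ := μ) hq hp n (extendPath x) y
  simp only [extendPath_val] at hx
  refine ⟨fun h z => ?_, fun h z => ?_⟩
  · have h1 := h fun i => z i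
    rw [hx, likelihood_eq_exp_pathEnergy hq hp] at h1
    exact le_of_mul_le_mul_left h1 hc
  · have hz := likelihood_eq_exp_pathEnergy (μ := μ) hq hp n (extendPath z) y
    simp only [extendPath_val] at hz
    rw [hx, hz]
    exact mul_le_mul_of_nonneg_left (h _) hc.le

theorem existsUnique_isLikelihoodMaximizer (h : IsStronglyLogConcaveModel μ α γ κ) (hcq : 0 < cq)
    (hcp : 0 < cp) (hq : ∀ u v, q u v = cq * Real.exp (-α u v))
    (hp : ∀ x y, p x y = cp * Real.exp (-γ x y)) (n : ℕ) (y : Fin n → ℝ) :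
    ∃! x, IsLikelihoodMaximizer μ q p n y x := by
  rcases n with _ | n
  · exact ⟨0, fun z => le_rfl, fun _ _ => Subsingleton.elim _ _⟩
  · have hy : y = fun i : Fin (n + 1) => extendPath y i := by simp
    rw [hy]
    obtain ⟨x, hx⟩ := h.exists_isPathMaximizer (extendPath y) n
    refine ⟨fun i => x i, fun z => ?_, fun z hz => funext fun i => ?_⟩
    · have hz := likelihood_eq_exp_pathEnergy (μ := μ) hq hp n (extendPath z) (extendPath y)
      simp only [extendPath_val] at hz
      simp only [extendPath_val]
      have hx' := likelihood_eq_exp_pathEnergy (μ := μ) hq hp n x (extendPath y)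
      simp only [extendPath_val] at hx'
      rw [hx', hz]
      exact mul_le_mul_of_nonneg_left (hx _) (by positivity)
    · have hz' := (isLikelihoodMaximizer_iff_isPathMaximizer hcq hcp hq hp n z _).1 hz
      have := h.eq_of_isPathMaximizer hz' hx (Nat.le_of_lt_succ i.isLt)
      rwa [extendPath_val] at this

/-- Uniqueness makes the lexicographic condition automatic, so the default value of `mapPath` is
never taken. -/
theorem isLikelihoodMaximizer_mapPath {n : ℕ} {y : Fin n → ℝ}
    (h : ∃! x, IsLikelihoodMaximizer μ q p n y x) :
    IsLikelihoodMaximizer μ q p n y (mapPath μ q p n y) := by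
  obtain ⟨x, hx, huniq⟩ := h
  have hex : ∃ x, IsMAPPath μ q p n y x := ⟨x, hx, fun z hz => by rw [huniq z hz]⟩
  rw [mapPath, dif_pos hex]
  exact hex.choose_spec.1

/-- Along observations for which the negative log-likelihood of some path grows at most linearly,
the increments of each entry of the MAP path decay geometrically. -/
theorem exists_geometric_bound_mapPath (h : IsStronglyLogConcaveModel μ α γ κ) (hcq : 0 < cq)
    (hcp : 0 < cp) (hq : ∀ u v, q u v = cq * Real.exp (-α u v))
    (hp : ∀ x y, p x y = cp * Real.exp (-γ x y))
    (hmixed : ∀ M : ℝ, 0 < M → ∃ G : ℝ, ∀ u v, α u v ≤ M → |mixedDeriv α u v| ≤ G)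
    {x y : ℕ → ℝ} (hx0 : 0 < μ (x 0)) {C : ℝ}
    (hgrowth : ∀ᶠ n : ℕ in atTop,
      -Real.log (likelihood μ q p n (fun i => x i) (fun i => y i)) / n ≤ C) :
    ∃ r : ℝ, 0 < r ∧ r < 1 ∧ ∃ N : ℕ, ∀ m, ∃ D : ℝ, ∀ n ≥ N, m ≤ n →
      |extendPath (mapPath μ q p (n + 2) fun j => y j) m -
        extendPath (mapPath μ q p (n + 1) fun j => y j) m| ≤ D * r ^ n := by
  obtain ⟨N, hN⟩ := eventually_atTop.1 hgrowth
  have hmax : ∀ n, IsPathMaximizer μ α γ y n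
      (extendPath (mapPath μ q p (n + 1) fun j => y j)) := fun n =>
    (isLikelihoodMaximizer_iff_isPathMaximizer hcq hcp hq hp n _ y).1
      (isLikelihoodMaximizer_mapPath
        (existsUnique_isLikelihoodMaximizer h hcq hcp hq hp (n + 1) _))
  obtain ⟨r, hr0, hr1, hr⟩ := h.exists_geometric_bound hmixed
    (x := fun n => extendPath (mapPath μ q p (n + 1) fun j => y j)) (N := N)
    (K := C + |Real.log cp| + |Real.log cq|) hmax (fun n hn => by
      -- The path `x` is the competitor. Its length `n + 1` involves `n + 1` factors `cp` and `n`
      -- factors `cq`, whose logarithms are absorbed into `K`.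
      refine (h.energy_le_of_isPathMaximizer (hmax n) hx0).trans ?_
      have h1 := hN (n + 1) (by omega)
      rw [likelihood_eq_exp_pathEnergy hq hp, Real.log_mul (by positivity) (by positivity),
        Real.log_mul (by positivity) (by positivity), Real.log_mul (by positivity) (by positivity),
        Real.log_exp, Real.log_pow, Real.log_pow, div_le_iff₀ (by positivity)] at h1
      push_cast at h1
      have h2 : (n + 1 : ℝ) * Real.log cp ≤ (n + 1) * |Real.log cp| :=
        mul_le_mul_of_nonneg_left (le_abs_self _) (by positivity)
      have h3 : (n : ℝ) * Real.log cq ≤ n * |Real.log cq| :=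
        mul_le_mul_of_nonneg_left (le_abs_self _) (by positivity)
      linarith [abs_nonneg (Real.log cq)])
  exact ⟨r, hr0, hr1, N, hr⟩

end MAPPath

/-! ### Almost sure conclusions -/

theorem exists_tendsto_of_abs_sub_le_geometric {f : ℕ → ℝ} {D r : ℝ} {N : ℕ} (hr : r < 1)
    (h : ∀ n ≥ N, |f (n + 1) - f n| ≤ D * r ^ n) : ∃ l, Tendsto f atTop (𝓝 l) := by
  have hcauchy : CauchySeq fun k => f (k + N) := by
    refine cauchySeq_of_le_geometric r (D * r ^ N) hr fun k => ?_
    rw [dist_comm, Real.dist_eq, Nat.add_right_comm, mul_assoc, ← pow_add, Nat.add_comm N k]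
    exact h (k + N) (Nat.le_add_left _ _)
  obtain ⟨l, hl⟩ := cauchySeq_tendsto_of_complete hcauchy
  exact ⟨l, (tendsto_add_atTop_iff_nat N).1 hl⟩

/-- A law with density `μ` does not charge `{μ = 0}`. Thus the hidden path is almost surely a
competitor of finite energy, and `μ` is positive somewhere. -/
theorem IsHiddenMarkovModel.ae_init_pos {Ω : Type*} [MeasurableSpace Ω] {P : Measure Ω}
    {X Y : ℕ → Ω → ℝ} {μ : ℝ → ℝ} {q p : ℝ → ℝ → ℝ} (h : IsHiddenMarkovModel P X Y μ q p) :
    ∀ᵐ ω ∂P, 0 < μ (X 0 ω) := by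
  have hmap : ∀ᵐ u ∂P.map (X 0), 0 < μ u := by
    rw [h.init, ae_withDensity_iff h.measurable_init_density.ennreal_ofReal]
    exact Eventually.of_forall fun u hu => ENNReal.ofReal_pos.1 (pos_iff_ne_zero.2 hu)
  exact ae_of_ae_map (h.measurable_state 0).aemeasurable hmap

theorem mainTheorem1 {Ω : Type*} [MeasurableSpace Ω] (P : Measure Ω) [IsProbabilityMeasure P]
    (X Y : ℕ → Ω → ℝ) (μ : ℝ → ℝ) (q p : ℝ → ℝ → ℝ)
    (hHMM : IsHiddenMarkovModel P X Y μ q p)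
    -- initial density
    (hμ_smooth : ContDiff ℝ 2 μ) (hμ_conc : LogConcave μ) (hμ_nonneg : ∀ u, 0 ≤ -Real.log (μ u))
    -- transition density
    (α : ℝ → ℝ → ℝ) (cq : ℝ) (hcq : 0 < cq) (hq : ∀ u v, q u v = cq * Real.exp (-α u v))
    (hα_nonneg : ∀ u v, 0 ≤ α u v) (hα_smooth : ContDiff ℝ 2 (Function.uncurry α))
    (hα_conv : ConvexOn ℝ Set.univ (Function.uncurry α))
    -- observation density
    (γ : ℝ → ℝ → ℝ) (cp : ℝ) (hcp : 0 < cp) (hp : ∀ x y, p x y = cp * Real.exp (-γ x y))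
    (hγ_nonneg : ∀ x y, 0 ≤ γ x y) (hγ_smooth : ∀ y, ContDiff ℝ 2 (fun x => γ x y))
    (κ : ℝ) (hκ : 0 < κ) (hγ_conv : ∀ x y, κ ≤ iteratedDeriv 2 (fun x' => γ x' y) x)
    -- linear growth of the negative log-likelihood along the true path
    (hgrowth : ∃ C : ℝ, ∀ᵐ ω ∂P,
      limsup (fun n : ℕ =>
        ((-Real.log (likelihood μ q p n (fun i => X i ω) (fun i => Y i ω)) / n : ℝ) : EReal))
        atTop ≤ (C : EReal))
    -- polynomial control of the mixed derivative on sublevel sets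
    (hmixed : ∃ g : ℝ≥0 → ℝ≥0, Monotone g ∧ Tendsto g atTop atTop ∧
      (∃ k : ℕ, (fun M : ℝ≥0 => (g M : ℝ)) =O[atTop] fun M : ℝ≥0 => (M : ℝ) ^ k) ∧
      ∀ M : ℝ≥0, 0 < M → ∀ x y : ℝ, α x y ≤ M → |mixedDeriv α x y| ≤ g M) :
    -- the MAP path is well defined: the likelihood has exactly one maximizer
    (∀ (n : ℕ) (y : Fin n → ℝ), ∃! x, IsLikelihoodMaximizer μ q p n y x) ∧
    -- for fixed m, the first m entries of the MAP path of length n = m + k converge a.s.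
    (∀ m : ℕ, ∀ᵐ ω ∂P, ∃ ℓ : Fin m → ℝ,
      Tendsto (fun k : ℕ => fun i : Fin m =>
        mapPath μ q p (m + k) (fun j => Y j ω) (Fin.castAdd k i)) atTop (𝓝 ℓ)) ∧
    -- superpolynomial decay of the increments of the first entry
    (∀ᵐ ω ∂P, ∀ r : ℕ, Tendsto (fun n : ℕ => ((n + 1 : ℕ) : ℝ) ^ r *
      |mapPath μ q p (n + 2) (fun j => Y j ω) 0 - mapPath μ q p (n + 1) (fun j => Y j ω) 0|)
      atTop (𝓝 0)) := by
  have hpos := hHMM.ae_init_pos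
  have h : IsStronglyLogConcaveModel μ α γ κ :=
    { init_smooth := hμ_smooth
      init_conc := hμ_conc
      init_log_nonpos := hμ_nonneg
      init_pos := hpos.exists.imp' (fun ω => X 0 ω) fun _ hω => hω
      trans_nonneg := hα_nonneg
      trans_smooth := hα_smooth
      trans_conv := hα_conv
      obs_nonneg := hγ_nonneg
      obs_smooth := hγ_smooth
      curvature_pos := hκ
      obs_conv := hγ_conv }
  obtain ⟨g, -, -, -, hg⟩ := hmixed
  have hmixed' : ∀ M : ℝ, 0 < M → ∃ G : ℝ, ∀ u v, α u v ≤ M → |mixedDeriv α u v| ≤ G :=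
    fun M hM => ⟨g ⟨M, hM.le⟩, hg ⟨M, hM.le⟩ hM⟩
  obtain ⟨C, hC⟩ := hgrowth
  have hdecay : ∀ᵐ ω ∂P, ∃ r : ℝ, 0 < r ∧ r < 1 ∧ ∃ N : ℕ, ∀ m, ∃ D : ℝ, ∀ n ≥ N, m ≤ n →
      |extendPath (mapPath μ q p (n + 2) fun j => Y j ω) m -
        extendPath (mapPath μ q p (n + 1) fun j => Y j ω) m| ≤ D * r ^ n := by
    filter_upwards [hpos, hC] with ω hω hCω
    refine exists_geometric_bound_mapPath h hcq hcp hq hp hmixed' (x := fun i => X i ω)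
      (y := fun i => Y i ω) hω (C := C + 1) ?_
    -- A limsup at most `C` gives an eventual bound only by a larger constant.
    have hlt : (C : EReal) < ((C + 1 : ℝ) : EReal) := EReal.coe_lt_coe_iff.2 (lt_add_one C)
    filter_upwards [eventually_lt_of_limsup_lt (hCω.trans_lt hlt)] with n hn
    exact (EReal.coe_lt_coe_iff.1 hn).le
  refine ⟨existsUnique_isLikelihoodMaximizer h hcq hcp hq hp, fun m => ?_, ?_⟩
  · filter_upwards [hdecay] with ω hω
    obtain ⟨r, -, hr1, N, hD⟩ := hω
    have hlim : ∀ i : Fin m, ∃ l, Tendsto (fun n =>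
        extendPath (mapPath μ q p n fun j => Y j ω) i) atTop (𝓝 l) := by
      intro i
      obtain ⟨D, hD⟩ := hD i
      -- Entry `i` is controlled only once the path has reached it, hence the maximum.
      obtain ⟨l, hl⟩ := exists_tendsto_of_abs_sub_le_geometric (N := max N i)
        (f := fun n => extendPath (mapPath μ q p (n + 1) fun j => Y j ω) i) hr1
        fun n hn => hD n (le_of_max_le_left hn) (le_of_max_le_right hn)
      exact ⟨l, (tendsto_add_atTop_iff_nat
        (f := fun n => extendPath (mapPath μ q p n fun j => Y j ω) i) 1).1 hl⟩
    choose l hl using hlim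
    refine ⟨l, tendsto_pi_nhds.2 fun i => ?_⟩
    refine ((hl i).comp (tendsto_atTop_mono (fun k => Nat.le_add_left k m) tendsto_id)).congr
      fun k => ?_
    exact extendPath_val _ (Fin.castAdd k i)
  · filter_upwards [hdecay] with ω hω s
    obtain ⟨r, hr0, hr1, N, hD⟩ := hω
    obtain ⟨D, hD⟩ := hD 0
    -- Geometric decay beats every power; dividing by `r` aligns the exponent with the length `n +
    -- 1`.
    have hlim : Tendsto (fun n : ℕ => D / r * (((n + 1 : ℕ) : ℝ) ^ s * r ^ (n + 1))) atTop
        (𝓝 0) := by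
      have h1 := tendsto_pow_const_mul_const_pow_of_abs_lt_one s
        (by rwa [abs_of_pos hr0] : |r| < 1)
      simpa only [mul_zero] using ((tendsto_add_atTop_iff_nat 1).2 h1).const_mul (D / r)
    refine squeeze_zero' (Eventually.of_forall fun n => by positivity) ?_ hlim
    filter_upwards [eventually_ge_atTop N] with n hn
    have h1 := hD n hn (Nat.zero_le n)
    have h2 : D / r * (((n + 1 : ℕ) : ℝ) ^ s * r ^ (n + 1)) =
        ((n + 1 : ℕ) : ℝ) ^ s * (D * r ^ n) := by
      field_simp
      ring
    rw [h2]
    exact mul_le_mul_of_nonneg_left h1 (by positivity)
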